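/- Let $n\geq 2$. Let $\mathcal T_n$ be the full transformation monoid on $\{1,\dots,n\}$, i.e. the monoid of all mappings $\{1,\dots,n\}\to\{1,\dots,n\}$, written to the right of their arguments and composed from left to right: $x(\alpha\beta)=(x\alpha)\beta$. A right congruence on $\mathcal T_n$ is an equivalence relation $\sigma$ on $\mathcal T_n$ such that $(\alpha,\beta)\in\sigma$ implies $(\alpha\gamma,\beta\gamma)\in\sigma$ for all $\gamma\in\mathcal T_n$; let $\mathsf{RCong}(\mathcal T_n)$ be the lattice of all right congruences on $\mathcal T_n$, ordered by inclusion. For a group $G$ let $\mathrm{Sub}(G)$ be the lattice of all subgroups of $G$, ordered by inclusion, and let $\mathcal S_r$ be the symmetric group of degree $r$. For a poset $P$ let $\mathrm{Ht}(P)$ denote the supremum of the cardinalities (numbers of elements) of the chains in $P$. Then \[ \mathrm{Ht}(\mathsf{RCong}(\mathcal T_n)) = 1+\sum_{r=1}^n S(n,r)\,\mathrm{Ht}(\mathrm{Sub}(\mathcal S_r)), \] where $S(n,r)$ is the Stirling number of the second kind, i.e. the number of partitions of an $n$-element set into $r$ non-empty blocks. -/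

import Mathlib

/-- A right congruence on a semigroup `S`: an equivalence relation `σ` on `S` such that
`(x, y) ∈ σ` implies `(x * a, y * a) ∈ σ` for all `a ∈ S`. -/
structure RightCongruence (S : Type*) [Semigroup S] extends Setoid S where
  mul_right : ∀ {x y : S} (a : S), r x y → r (x * a) (y * a)

namespace RightCongruence

theorem toSetoid_injective {S : Type*} [Semigroup S] :
    Function.Injective (toSetoid : RightCongruence S → Setoid S) := by
  rintro ⟨s, hs⟩ ⟨t, ht⟩ h
  cases h
  rfl

/-- Right congruences are ordered by inclusion of relations. -/
instance {S : Type*} [Semigroup S] : PartialOrder (RightCongruence S) :=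
  PartialOrder.lift toSetoid toSetoid_injective

theorem le_def {S : Type*} [Semigroup S] {σ τ : RightCongruence S} :
    σ ≤ τ ↔ ∀ {x y : S}, σ.r x y → τ.r x y := Iff.rfl

end RightCongruence

/-- The full transformation monoid: all mappings `{0, …, n - 1} → {0, …, n - 1}`. -/
def FullTransformation (n : ℕ) : Type := Fin n → Fin n

/-- Mappings are composed from left to right: `α * β` is "first `α`, then `β`". -/
instance (n : ℕ) : Monoid (FullTransformation n) where
  mul α β := fun x => β (α x)
  mul_assoc _ _ _ := rfl
  one := fun x => x
  one_mul _ := rfl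
  mul_one _ := rfl

/-- The height of a poset: the supremum of the cardinalities (numbers of elements) of its chains,
where all infinite cardinalities are identified with `⊤`. -/
noncomputable def posetHeight (P : Type*) [PartialOrder P] : ℕ∞ :=
  ⨆ c : {c : Set P // IsChain (· ≤ ·) c}, c.val.encard

/-!
Right multiplication of a mapping `α` is composition after `α`, so it can only enlarge the kernel
of `α`, a partition of `{0, …, n - 1}`. Fix a linear extension of the refinement order on these
partitions. For every partition `K` the mappings whose kernel comes after `K` form a right ideal
`above K`, and these ideals form a filtration whose layers are the sets of mappings with a given
kernel `K`; such a mapping amounts to an injection of the classes of `K` into `{0, …, n - 1}`.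

On a single layer there is little freedom for a right congruence `σ`. Either it *collapses* `K`
(`RightCongruence.Collapses`): it identifies a mapping with kernel `K` with a later one, and then,
by transitivity of right multiplication on the layer, each of them. Or it identifies two mappings
with kernel `K` only if their images agree, so that they differ by a permutation of the classes of
`K`; the permutations that occur form a subgroup, `RightCongruence.stabilizer`. Indeed two
mappings with different images are separated by a further mapping that is injective on one image
but not on the other, unless `K` has a single class; in that last case, two identified constants
force all constants to be identified. So there are the subgroups of the symmetric group on the
classes of `K`, and one more possibility above them: the layer contributes exactly
`posetHeight (Subgroup (Equiv.Perm (Quotient K)))` steps to the length of a chain.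

* Upper bound: the invariants of all the layers separate comparable right congruences
  (`RightCongruence.le_of_collapses_of_stabilizer_le`). Hence the sum of the heights of the local
  invariants is a strictly monotone rank function (`RightCongruence.sum_localRank_strictMono`).
* Lower bound: `RightCongruence.layer K H` identifies everything in `above K` and lets the subgroup
  `H` act on the layer of `K`. With `H` running through a longest chain of subgroups for each `K`,
  and together with the universal congruence, these form a chain of the required size
  (`RightCongruence.isChain_range_chainElement`, `RightCongruence.chainElement_injective`).

Finally, the number of partitions `K` with `r` classes is the Stirling number
(`Setoid.card_quotient_eq_stirlingSecond`).
-/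

/-! ### Heights of finite posets -/

theorem posetHeight_eq_chainHeight (P : Type*) [PartialOrder P] :
    posetHeight P = (Set.univ : Set P).chainHeight (· ≤ ·) := by
  refine le_antisymm (iSup_le fun c => ?_) (iSup_le fun c => ?_)
  · exact Set.encard_le_chainHeight_of_isChain _ _ (Set.subset_univ _) c.2
  · exact le_iSup (fun c : {c : Set P // IsChain (· ≤ ·) c} => c.val.encard) ⟨c.1, c.2.2⟩

theorem IsChain.encard_le_posetHeight {P : Type*} [PartialOrder P] {c : Set P}
    (hc : IsChain (· ≤ ·) c) : c.encard ≤ posetHeight P :=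
  le_iSup (fun c : {c : Set P // IsChain (· ≤ ·) c} => c.val.encard) ⟨c, hc⟩

theorem posetHeight_ne_top (P : Type*) [PartialOrder P] [Finite P] : posetHeight P ≠ ⊤ := by
  rw [posetHeight_eq_chainHeight]
  exact Set.chainHeight_ne_top_of_finite _ _ Set.finite_univ

theorem exists_isChain_encard_eq_posetHeight (P : Type*) [PartialOrder P] [Finite P] :
    ∃ c : Set P, IsChain (· ≤ ·) c ∧ c.encard = posetHeight P := by
  obtain ⟨c, -, h, hc⟩ := Set.exists_eq_chainHeight_of_finite (Set.univ : Set P) (· ≤ ·)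
    Set.finite_univ
  exact ⟨c, hc, by rw [h, posetHeight_eq_chainHeight]⟩

theorem OrderEmbedding.posetHeight_le {P Q : Type*} [PartialOrder P] [PartialOrder Q]
    (e : P ↪o Q) : posetHeight P ≤ posetHeight Q := by
  refine iSup_le fun ⟨c, hc⟩ => ?_
  rw [← e.injective.injOn.encard_image]
  refine IsChain.encard_le_posetHeight ?_
  rintro _ ⟨x, hx, rfl⟩ _ ⟨y, hy, rfl⟩ -
  exact (hc.total hx hy).imp e.le_iff_le.2 e.le_iff_le.2

theorem OrderIso.posetHeight_eq {P Q : Type*} [PartialOrder P] [PartialOrder Q] (e : P ≃o Q) :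
    posetHeight P = posetHeight Q :=
  le_antisymm e.toOrderEmbedding.posetHeight_le e.symm.toOrderEmbedding.posetHeight_le

/-- A poset with a strictly monotone map to `{0, …, N}` has chains of at most `N + 1` elements. -/
theorem posetHeight_le_of_strictMono {P : Type*} [PartialOrder P] {f : P → ℕ} (hf : StrictMono f)
    {N : ℕ} (hN : ∀ x, f x ≤ N) : posetHeight P ≤ N + 1 := by
  refine iSup_le fun ⟨c, hc⟩ => ?_
  have hinj : Set.InjOn f c := by
    intro x hx y hy hxy
    by_contra hne
    rcases hc.total hx hy with h | h
    · exact (hf (lt_of_le_of_ne h hne)).ne hxy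
    · exact (hf (lt_of_le_of_ne h (Ne.symm hne))).ne hxy.symm
  calc c.encard = (f '' c).encard := hinj.encard_image.symm
    _ ≤ (Set.Iic N).encard := Set.encard_le_encard (by rintro _ ⟨x, -, rfl⟩; exact hN x)
    _ = N + 1 := by
      rw [Set.encard_eq_coe_toFinset_card]
      simp

/-- The largest number of elements of a chain strictly below `x`. -/
noncomputable def heightBelow {P : Type*} [PartialOrder P] (x : P) : ℕ :=
  ((Set.Iio x).chainHeight (· ≤ ·)).toNat

theorem exists_isChain_heightBelow {P : Type*} [PartialOrder P] [Finite P] (x : P) :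
    ∃ c ⊆ Set.Iic x, IsChain (· ≤ ·) c ∧ c.encard = heightBelow x + 1 := by
  obtain ⟨c, hcx, hcard, hc⟩ :=
    Set.exists_eq_chainHeight_of_finite (Set.Iio x) (· ≤ ·) (Set.toFinite _)
  refine ⟨insert x c, ?_, hc.insert fun y hy _ => Or.inr (hcx hy).le, ?_⟩
  · exact Set.insert_subset le_rfl (hcx.trans Set.Iio_subset_Iic_self)
  · rw [Set.encard_insert_of_notMem fun h => (hcx h).false, hcard, heightBelow,
      ENat.natCast_toNat (Set.chainHeight_ne_top_of_finite _ _ (Set.toFinite _))]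

theorem heightBelow_strictMono {P : Type*} [PartialOrder P] [Finite P] :
    StrictMono (heightBelow : P → ℕ) := by
  intro x y hxy
  obtain ⟨c, hcx, hc, hcard⟩ := exists_isChain_heightBelow x
  have h := Set.encard_le_chainHeight_of_isChain (Set.Iio y) c
    (hcx.trans fun z hz => lt_of_le_of_lt hz hxy) hc
  rw [hcard, ← ENat.natCast_toNat (Set.chainHeight_ne_top_of_finite (Set.Iio y) (· ≤ ·)
    (Set.toFinite _))] at h
  exact_mod_cast h

theorem heightBelow_lt_posetHeight {P : Type*} [PartialOrder P] [Finite P] (x : P) :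
    heightBelow x < (posetHeight P).toNat := by
  obtain ⟨c, -, hc, hcard⟩ := exists_isChain_heightBelow x
  have h := hc.encard_le_posetHeight
  rw [hcard, ← ENat.natCast_toNat (posetHeight_ne_top P)] at h
  exact_mod_cast h

/-! ### Counting equivalence relations -/

instance Setoid.instFinite (α : Type*) [Finite α] : Finite (Setoid α) :=
  Finite.of_injective (fun s : Setoid α => s.r) fun s t h => by
    cases s; cases t; cases h; rfl

/-- Extends an equivalence relation `s` to one more point: the new point joins the class `q` if
the second component is `some q`, and forms a class of its own if it is `none`. -/
def Setoid.extendOption {α : Type*} (p : Σ s : Setoid α, Option (Quotient s)) :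
    Setoid (Option α) :=
  Setoid.ker fun y : Option α => y.elim p.2 fun x => some (Quotient.mk p.1 x)

theorem Setoid.extendOption_some_some {α : Type*} {p : Σ s : Setoid α, Option (Quotient s)}
    {x y : α} : Setoid.extendOption p (some x) (some y) ↔ p.1 x y :=
  (Option.some_injective _).eq_iff.trans Quotient.eq

theorem Setoid.extendOption_none_some {α : Type*} {p : Σ s : Setoid α, Option (Quotient s)}
    {x : α} : Setoid.extendOption p none (some x) ↔ p.2 = some (Quotient.mk p.1 x) :=
  Iff.rfl

theorem Setoid.extendOption_bijective (α : Type*) :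
    Function.Bijective (Setoid.extendOption (α := α)) := by
  constructor
  · rintro ⟨s, o⟩ ⟨t, o'⟩ h
    obtain rfl : s = t := by
      ext x y
      rw [← extendOption_some_some (p := ⟨s, o⟩), h, extendOption_some_some]
    have hmem : ∀ q, o = some q ↔ o' = some q := by
      intro q
      induction q using Quotient.inductionOn with | _ x
      rw [← extendOption_none_some (p := ⟨s, o⟩), h, extendOption_none_some]
    rw [Option.ext hmem]
  · intro t
    -- The class of the new point is determined by the old points related to it, if any.
    obtain ⟨o, ho⟩ : ∃ o : Option (Quotient (t.comap some)),
        ∀ x, o = some (Quotient.mk _ x) ↔ t none (some x) := by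
      by_cases h : ∃ x, t none (some x)
      · obtain ⟨x, hx⟩ := h
        refine ⟨some (Quotient.mk _ x), fun y => ?_⟩
        rw [Option.some_inj, Quotient.eq, Setoid.comap_rel]
        exact ⟨t.trans hx, t.trans (t.symm hx)⟩
      · exact ⟨none, fun y => ⟨fun h => (Option.some_ne_none _ h.symm).elim,
          fun hy => absurd ⟨y, hy⟩ h⟩⟩
    refine ⟨⟨t.comap some, o⟩, Setoid.ext fun a b => ?_⟩
    rcases a with _ | a <;> rcases b with _ | b
    · exact ⟨fun _ => t.refl _, fun _ => Setoid.refl' _ _⟩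
    · rw [extendOption_none_some, ho]
    · rw [Setoid.comm', extendOption_none_some, ho, Setoid.comm']
    · rw [extendOption_some_some, Setoid.comap_rel]

theorem Setoid.card_quotient_extendOption {α : Type*} [Finite α]
    (p : Σ s : Setoid α, Option (Quotient s)) :
    Nat.card (Quotient (Setoid.extendOption p)) =
      Nat.card (Quotient p.1) + if p.2 = none then 1 else 0 := by
  obtain ⟨s, o⟩ := p
  rw [extendOption, Nat.card_congr (Setoid.quotientKerEquivRange _)]
  cases o with
  | none =>
    have : Set.range (fun y : Option α => y.elim none fun x => some (Quotient.mk s x)) =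
        Set.univ := by
      rw [Set.range_eq_univ]
      rintro (_ | q)
      · exact ⟨none, rfl⟩
      · induction q using Quotient.inductionOn with | _ x
        exact ⟨some x, rfl⟩
    simp only [this, if_true]
    rw [Nat.card_coe_set_eq, Set.ncard_univ, Finite.card_option]
  | some q =>
    have : Set.range (fun y : Option α => y.elim (some q) fun x => some (Quotient.mk s x)) =
        Set.range some := by
      ext o
      constructor
      · rintro ⟨_ | x, rfl⟩
        · exact ⟨q, rfl⟩
        · exact ⟨_, rfl⟩
      · rintro ⟨q, rfl⟩
        induction q using Quotient.inductionOn with | _ x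
        exact ⟨some x, rfl⟩
    simp only [this]
    simpa using Nat.card_range_of_injective (Option.some_injective (Quotient s))

/-- The number of partitions of an `n`-element set into `k` blocks is the Stirling number of the
second kind. -/
theorem Setoid.card_quotient_eq_stirlingSecond (n k : ℕ) :
    Nat.card {s : Setoid (Fin n) // Nat.card (Quotient s) = k} = Nat.stirlingSecond n k := by
  induction n generalizing k with
  | zero =>
    have h0 : ∀ s : Setoid (Fin 0), Nat.card (Quotient s) = 0 := fun s => by
      have : IsEmpty (Quotient s) := ⟨fun q => Quotient.inductionOn q fun x => x.elim0⟩
      simp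
    have : Subsingleton (Setoid (Fin 0)) := ⟨fun s t => Setoid.ext fun x => x.elim0⟩
    cases k with
    | zero =>
      rw [Nat.stirlingSecond_zero, Nat.card_eq_one_iff_unique]
      exact ⟨inferInstance, ⟨⟨⊥, h0 _⟩⟩⟩
    | succ k => simp
  | succ n ih =>
    classical
    let : Fintype (Setoid (Fin n)) := Fintype.ofFinite _
    let : ∀ s : Setoid (Fin n), Fintype (Quotient s) := fun _ => Fintype.ofFinite _
    have hcard : Nat.card {s : Setoid (Fin (n + 1)) // Nat.card (Quotient s) = k} =
        Nat.card {p : Σ s : Setoid (Fin n), Option (Quotient s) //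
          Nat.card (Quotient p.1) + (if p.2 = none then 1 else 0) = k} := by
      let e : Fin (n + 1) ≃ Option (Fin n) := finSuccEquiv n
      have hbij : Function.Bijective fun p => (extendOption (α := Fin n) p).comap e :=
        ⟨(comap_injective e e.surjective).comp (extendOption_bijective _).1, fun t => by
          obtain ⟨p, hp⟩ := (extendOption_bijective _).2 (t.comap e.symm)
          refine ⟨p, Setoid.ext fun x y => ?_⟩
          change extendOption p (e x) (e y) ↔ t x y
          rw [hp, comap_rel, e.symm_apply_apply, e.symm_apply_apply]⟩
      refine (Nat.card_congr ((Equiv.ofBijective _ hbij).subtypeEquiv fun p => ?_)).symm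
      rw [← card_quotient_extendOption, Equiv.ofBijective_apply,
        Nat.card_congr (Quotient.congr (ra := (extendOption p).comap e) (rb := extendOption p) e
          fun _ _ => Iff.rfl)]
    have hsum : Nat.card {s : Setoid (Fin (n + 1)) // Nat.card (Quotient s) = k} =
        Nat.card {s : Setoid (Fin n) // Nat.card (Quotient s) + 1 = k} +
          k * Nat.card {s : Setoid (Fin n) // Nat.card (Quotient s) = k} := by
      rw [hcard]
      rw [Nat.card_eq_fintype_card, Nat.card_eq_fintype_card, Nat.card_eq_fintype_card]
      simp only [Fintype.card_subtype, Finset.card_filter, Finset.mul_sum]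
      rw [← Finset.univ_sigma_univ, Finset.sum_sigma, ← Finset.sum_add_distrib]
      refine Finset.sum_congr rfl fun s _ => ?_
      rw [Fintype.sum_option]
      by_cases h : Fintype.card (Quotient s) = k <;> simp [h]
    rw [hsum]
    cases k with
    | zero =>
      simp
    | succ k =>
      simp only [add_left_inj, ih, Nat.stirlingSecond_succ_succ]
      ring

/-! ### Kernels, images and right multiplication -/

namespace FullTransformation

variable {n : ℕ}

theorem mul_apply (α γ : FullTransformation n) (x : Fin n) : (α * γ) x = γ (α x) := rfl

/-- The kernel of a mapping: the partition of its domain into fibres. Two mappings generate the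
same right ideal exactly if they have the same kernel. -/
def ker (α : FullTransformation n) : Setoid (Fin n) := Setoid.ker α

theorem ker_apply {α : FullTransformation n} {x y : Fin n} : ker α x y ↔ α x = α y := Iff.rfl

theorem ker_le_ker_mul (α γ : FullTransformation n) : ker α ≤ ker (α * γ) :=
  fun _ _ h => congrArg γ h

/-- The mapping with kernel containing `K` that is induced by a mapping of the classes of `K`. -/
def ofQuotient (K : Setoid (Fin n)) (f : Quotient K → Fin n) : FullTransformation n :=
  fun x => f (Quotient.mk K x)

theorem ofQuotient_mul (K : Setoid (Fin n)) (f : Quotient K → Fin n) (γ : FullTransformation n) :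
    ofQuotient K f * γ = ofQuotient K (γ ∘ f) := rfl

theorem ofQuotient_injective (K : Setoid (Fin n)) : Function.Injective (ofQuotient K) :=
  fun _ _ h => funext fun q => Quotient.inductionOn q fun x => congrFun h x

theorem range_ofQuotient (K : Setoid (Fin n)) (f : Quotient K → Fin n) :
    Set.range (ofQuotient K f) = Set.range f :=
  Quotient.mk_surjective.range_comp f

theorem le_ker_ofQuotient (K : Setoid (Fin n)) (f : Quotient K → Fin n) :
    K ≤ ker (ofQuotient K f) :=
  fun _ _ h => congrArg f (Quotient.sound h)

theorem ker_ofQuotient_eq_iff {K : Setoid (Fin n)} {f : Quotient K → Fin n} :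
    ker (ofQuotient K f) = K ↔ Function.Injective f := by
  constructor
  · intro h p q
    induction p, q using Quotient.inductionOn₂ with | _ x y
    intro hxy
    refine Quotient.sound ?_
    have : ker (ofQuotient K f) x y := hxy
    rwa [h] at this
  · exact fun hf => le_antisymm (fun x y h => Quotient.exact (hf h)) (le_ker_ofQuotient K f)

theorem exists_ofQuotient_eq {K : Setoid (Fin n)} {α : FullTransformation n} (h : K ≤ ker α) :
    ∃ f, ofQuotient K f = α :=
  ⟨Quotient.lift α fun _ _ hxy => h hxy, rfl⟩

/-- Mappings with smaller kernel are taken to mappings with larger kernel by right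
multiplication. -/
theorem exists_mul_eq_of_ker_le [NeZero n] {α β : FullTransformation n} (h : ker α ≤ ker β) :
    ∃ γ : FullTransformation n, α * γ = β := by
  have hβ : β.FactorsThrough α := fun x y hxy => h hxy
  exact ⟨Function.extend α β fun _ => 0, funext fun x => hβ.extend_apply _ x⟩

/-- Mappings with the same kernel and the same image differ by a permutation of the kernel
classes. -/
theorem exists_perm_of_range_eq {K : Setoid (Fin n)} {f g : Quotient K → Fin n}
    (hf : Function.Injective f) (hg : Function.Injective g) (h : Set.range f = Set.range g) :
    ∃ π : Equiv.Perm (Quotient K), g = f ∘ π := by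
  refine ⟨(Equiv.ofInjective g hg).trans ((Equiv.setCongr h.symm).trans
    (Equiv.ofInjective f hf).symm), funext fun q => ?_⟩
  have := Equiv.apply_ofInjective_symm hf (Equiv.setCongr h.symm (Equiv.ofInjective g hg q))
  exact this.symm

theorem exists_injective_quotient (K : Setoid (Fin n)) :
    ∃ f : Quotient K → Fin n, Function.Injective f :=
  ⟨Quotient.out, Quotient.out_injective⟩

/-- The mappings whose kernel comes after `K` in a fixed linear extension of the refinement order
of partitions. They form a right ideal. -/
def above (K : Setoid (Fin n)) : Set (FullTransformation n) :=
  {β | toLinearExtension K < toLinearExtension (ker β)}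

theorem mul_mem_above {K : Setoid (Fin n)} {α : FullTransformation n} (h : α ∈ above K)
    (γ : FullTransformation n) : α * γ ∈ above K :=
  lt_of_lt_of_le h (toLinearExtension.monotone (ker_le_ker_mul α γ))

theorem mem_above_of_lt {K : Setoid (Fin n)} {α : FullTransformation n} (h : K < ker α) :
    α ∈ above K :=
  lt_of_le_of_ne (toLinearExtension.monotone h.le) h.ne

theorem ofQuotient_mem_above_iff {K : Setoid (Fin n)} {f : Quotient K → Fin n} :
    ofQuotient K f ∈ above K ↔ ¬ Function.Injective f := by
  rw [← ker_ofQuotient_eq_iff]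
  refine ⟨fun h h' => ?_, fun h => mem_above_of_lt (lt_of_le_of_ne (le_ker_ofQuotient K f)
    (Ne.symm h))⟩
  have h : toLinearExtension K < toLinearExtension (ker (ofQuotient K f)) := h
  exact h.ne (congrArg toLinearExtension h'.symm)

theorem notMem_above_top (α : FullTransformation n) : α ∉ above ⊤ :=
  fun h => (lt_of_lt_of_le h (toLinearExtension.monotone le_top)).false

end FullTransformation

open FullTransformation

namespace RightCongruence

variable {n : ℕ}

theorem refl {S : Type*} [Semigroup S] (σ : RightCongruence S) (x : S) : σ.r x x :=
  σ.iseqv.refl x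

theorem symm {S : Type*} [Semigroup S] (σ : RightCongruence S) {x y : S} (h : σ.r x y) :
    σ.r y x :=
  σ.iseqv.symm h

theorem trans {S : Type*} [Semigroup S] (σ : RightCongruence S) {x y z : S} (h : σ.r x y)
    (h' : σ.r y z) : σ.r x z :=
  σ.iseqv.trans h h'

/-! ### The invariants of a right congruence -/

/-- The permutations `π` of the classes of `K` such that `σ` identifies every mapping with kernel
`K` with the mapping obtained by permuting its kernel classes by `π`. -/
def stabilizer (σ : RightCongruence (FullTransformation n)) (K : Setoid (Fin n)) :
    Subgroup (Equiv.Perm (Quotient K)) where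
  carrier := {π | ∀ f : Quotient K → Fin n, Function.Injective f →
    σ.r (ofQuotient K f) (ofQuotient K (f ∘ π))}
  one_mem' f _ := σ.refl _
  mul_mem' {π ρ} hπ hρ f hf := σ.trans (hπ f hf) (hρ (f ∘ π) (hf.comp π.injective))
  inv_mem' {π} hπ f hf := by
    have h := hπ (f ∘ ⇑π⁻¹) (hf.comp (π⁻¹).injective)
    have : (f ∘ ⇑π⁻¹) ∘ π = f := by ext q; simp
    rw [this] at h
    exact σ.symm h

/-- `σ` identifies a mapping with kernel `K` with a mapping that comes later in the linear
extension, or with one with kernel `K` and a different image. The second alternative only matters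
when `K` has a single class: otherwise it implies the first. -/
def Collapses (σ : RightCongruence (FullTransformation n)) (K : Setoid (Fin n)) : Prop :=
  ∃ α β, σ.r α β ∧ ker α = K ∧ (β ∈ above K ∨ ker β = K ∧ Set.range α ≠ Set.range β)

theorem Collapses.mono {σ τ : RightCongruence (FullTransformation n)} (h : σ ≤ τ)
    {K : Setoid (Fin n)} (hσ : σ.Collapses K) : τ.Collapses K := by
  obtain ⟨α, β, hαβ, h'⟩ := hσ
  exact ⟨α, β, h hαβ, h'⟩

theorem stabilizer_mono {σ τ : RightCongruence (FullTransformation n)} (h : σ ≤ τ)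
    (K : Setoid (Fin n)) : σ.stabilizer K ≤ τ.stabilizer K :=
  fun _ hπ f hf => h (hπ f hf)

/-- Membership in the stabilizer can be tested on a single mapping with kernel `K`, since right
multiplication acts transitively on these. -/
theorem mem_stabilizer_of_rel [NeZero n] (σ : RightCongruence (FullTransformation n))
    {K : Setoid (Fin n)} {f : Quotient K → Fin n} (hf : Function.Injective f)
    {π : Equiv.Perm (Quotient K)} (h : σ.r (ofQuotient K f) (ofQuotient K (f ∘ π))) :
    π ∈ σ.stabilizer K := by
  intro g hg
  have hker : ker (ofQuotient K f) ≤ ker (ofQuotient K g) := by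
    rw [ker_ofQuotient_eq_iff.2 hf, ker_ofQuotient_eq_iff.2 hg]
  obtain ⟨γ, hγ⟩ := exists_mul_eq_of_ker_le hker
  obtain rfl : γ ∘ f = g := ofQuotient_injective K hγ
  exact σ.mul_right γ h

/-- A right congruence that collapses a kernel with at least two classes identifies every mapping
with that kernel with a later one. -/
theorem Collapses.exists_rel_mem_above [NeZero n] {σ : RightCongruence (FullTransformation n)}
    {K : Setoid (Fin n)} (h : σ.Collapses K) (hK : K ≠ ⊤) {α : FullTransformation n}
    (hα : ker α = K) : ∃ β ∈ above K, σ.r α β := by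
  suffices ∃ α₀ β₀, σ.r α₀ β₀ ∧ ker α₀ = K ∧ β₀ ∈ above K by
    obtain ⟨α₀, β₀, hr, hα₀, hβ₀⟩ := this
    obtain ⟨γ, rfl⟩ := exists_mul_eq_of_ker_le (hα₀.trans hα.symm).le
    exact ⟨β₀ * γ, mul_mem_above hβ₀ γ, σ.mul_right γ hr⟩
  obtain ⟨α₀, β₀, hr, hα₀, hβ₀ | ⟨hβ₀, hrange⟩⟩ := h
  · exact ⟨α₀, β₀, hr, hα₀, hβ₀⟩
  obtain ⟨f, rfl⟩ := exists_ofQuotient_eq hα₀.ge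
  obtain ⟨g, rfl⟩ := exists_ofQuotient_eq hβ₀.ge
  rw [range_ofQuotient, range_ofQuotient] at hrange
  rw [ker_ofQuotient_eq_iff] at hα₀ hβ₀
  -- The images have the same size, so there is a point `g q` outside of the image of `f`.
  obtain ⟨q, hq⟩ : ∃ q, g q ∉ Set.range f := by
    by_contra! hsub
    refine hrange (Set.eq_of_subset_of_ncard_le (Set.range_subset_iff.2 hsub) ?_).symm
    rw [← Set.image_univ, ← Set.image_univ, Set.ncard_image_of_injective _ hα₀,
      Set.ncard_image_of_injective _ hβ₀]
  obtain ⟨q', hq'⟩ : ∃ q', q' ≠ q := by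
    by_contra! hall
    exact hK (top_unique fun x y _ => Quotient.exact ((hall _).trans (hall _).symm))
  -- Moving `g q` to another point of the image of `g` fixes `f` and makes `g` non-injective.
  let γ : FullTransformation n := Function.update id (g q) (g q')
  have hγf : γ ∘ f = f := funext fun p =>
    Function.update_of_ne (fun hp => hq ⟨p, hp⟩) _ _
  have hγ := σ.mul_right γ hr
  rw [ofQuotient_mul, ofQuotient_mul, hγf] at hγ
  refine ⟨_, _, hγ, ker_ofQuotient_eq_iff.2 hα₀, ofQuotient_mem_above_iff.2 fun hinj => ?_⟩
  refine hq' (hinj ?_)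
  change Function.update id (g q) (g q') (g q') = Function.update id (g q) (g q') (g q)
  rw [Function.update_self, Function.update_of_ne (hβ₀.ne hq')]
  rfl

/-- A right congruence that collapses the universal kernel identifies all constant mappings. -/
theorem Collapses.rel_of_ker_eq_top {σ : RightCongruence (FullTransformation n)}
    (h : σ.Collapses ⊤) {α β : FullTransformation n} (hα : ker α = ⊤) (hβ : ker β = ⊤) :
    σ.r α β := by
  obtain ⟨α₀, β₀, hr, hα₀, hβ₀ | ⟨hβ₀, hrange⟩⟩ := h
  · exact absurd hβ₀ (notMem_above_top _)
  have hconst : ∀ {δ : FullTransformation n}, ker δ = ⊤ → ∀ x y, δ x = δ y := fun {δ} hδ x y =>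
    ker_apply.1 (by rw [hδ]; trivial)
  rcases isEmpty_or_nonempty (Fin n) with hn | ⟨⟨x⟩⟩
  · rw [show α = β from funext fun x => hn.elim x]
  have hne : α₀ x ≠ β₀ x := fun h => hrange (congrArg Set.range (funext fun y => by
    rw [hconst hα₀ y x, h, hconst hβ₀ x y]))
  let γ : FullTransformation n := Function.update (fun _ => β x) (α₀ x) (α x)
  have h₁ : α₀ * γ = α := funext fun y => by
    rw [mul_apply, hconst hα₀ y x, hconst hα y x]
    exact Function.update_self _ _ _
  have h₂ : β₀ * γ = β := funext fun y => by
    rw [mul_apply, hconst hβ₀ y x, hconst hβ y x]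
    exact Function.update_of_ne hne.symm _ _
  rw [← h₁, ← h₂]
  exact σ.mul_right γ hr

/-- A right congruence is determined, among those below it, by its invariants. -/
theorem le_of_collapses_of_stabilizer_le [NeZero n] {σ τ : RightCongruence (FullTransformation n)}
    (hle : σ ≤ τ) (hcol : ∀ K, τ.Collapses K → σ.Collapses K)
    (hstab : ∀ K, ¬ τ.Collapses K → τ.stabilizer K ≤ σ.stabilizer K) : τ ≤ σ := by
  -- Induction along the linear extension, starting from the constant mappings.
  have key : ∀ K : LinearExtension (Setoid (Fin n)), ∀ α β : FullTransformation n,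
      toLinearExtension (ker α) = K → K ≤ toLinearExtension (ker β) → τ.r α β → σ.r α β := by
    have : Finite (LinearExtension (Setoid (Fin n))) := inferInstanceAs (Finite (Setoid (Fin n)))
    intro K
    induction K using WellFoundedGT.induction with | _ K ih
    rintro α β rfl hβ hr
    have hβ' : β ∈ above (ker α) ∨ ker β = ker α := (lt_or_eq_of_le hβ).imp id Eq.symm
    by_cases hc : τ.Collapses (ker α)
    · by_cases htop : ker α = ⊤
      · rw [htop] at hc
        refine (hcol _ hc).rel_of_ker_eq_top htop ?_
        rw [htop] at hβ'
        exact hβ'.resolve_left (notMem_above_top _)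
      · have hσ := hcol _ hc
        obtain ⟨α', hα', hrα⟩ := hσ.exists_rel_mem_above htop rfl
        obtain ⟨β', hβ', hrβ⟩ : ∃ β' ∈ above (ker α), σ.r β β' := by
          rcases hβ' with h | h
          · exact ⟨β, h, σ.refl _⟩
          · exact hσ.exists_rel_mem_above htop h
        have hrτ : τ.r α' β' := τ.trans (τ.symm (hle hrα)) (τ.trans hr (hle hrβ))
        refine σ.trans hrα (σ.trans ?_ (σ.symm hrβ))
        rcases le_total (toLinearExtension (ker α')) (toLinearExtension (ker β')) with h | h
        · exact ih _ hα' _ _ rfl h hrτ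
        · exact σ.symm (ih _ hβ' _ _ rfl h (τ.symm hrτ))
    · have hker : ker β = ker α := hβ'.resolve_left fun h => hc ⟨α, β, hr, rfl, Or.inl h⟩
      have hrange : Set.range α = Set.range β := by
        by_contra h
        exact hc ⟨α, β, hr, rfl, Or.inr ⟨hker, h⟩⟩
      generalize hK : ker α = K at *
      obtain ⟨f, rfl⟩ := exists_ofQuotient_eq hK.ge
      obtain ⟨g, rfl⟩ := exists_ofQuotient_eq hker.ge
      rw [range_ofQuotient, range_ofQuotient] at hrange
      rw [ker_ofQuotient_eq_iff] at hK hker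
      obtain ⟨π, rfl⟩ := exists_perm_of_range_eq hK hker hrange
      exact hstab K hc (τ.mem_stabilizer_of_rel hK hr) f hK
  intro α β hr
  rcases le_total (toLinearExtension (ker α)) (toLinearExtension (ker β)) with h | h
  · exact key _ α β rfl h hr
  · exact σ.symm (key _ β α rfl h (τ.symm hr))

open Classical in
/-- The contribution of the mappings with kernel `K` to the rank of `σ`. -/
noncomputable def localRank (σ : RightCongruence (FullTransformation n)) (K : Setoid (Fin n)) :
    ℕ :=
  if σ.Collapses K then (posetHeight (Subgroup (Equiv.Perm (Quotient K)))).toNat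
  else heightBelow (σ.stabilizer K)

theorem localRank_le (σ : RightCongruence (FullTransformation n)) (K : Setoid (Fin n)) :
    σ.localRank K ≤ (posetHeight (Subgroup (Equiv.Perm (Quotient K)))).toNat := by
  unfold localRank
  split_ifs
  · exact le_rfl
  · exact (heightBelow_lt_posetHeight _).le

theorem localRank_mono {σ τ : RightCongruence (FullTransformation n)} (h : σ ≤ τ)
    (K : Setoid (Fin n)) : σ.localRank K ≤ τ.localRank K := by
  by_cases hτ : τ.Collapses K
  · rw [localRank.eq_1 τ, if_pos hτ]
    exact localRank_le σ K
  · rw [localRank, localRank, if_neg hτ, if_neg fun hσ => hτ (hσ.mono h)]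
    exact heightBelow_strictMono.monotone (stabilizer_mono h K)

theorem sum_localRank_strictMono [NeZero n] [Fintype (Setoid (Fin n))] :
    StrictMono fun σ : RightCongruence (FullTransformation n) => ∑ K, σ.localRank K := by
  intro σ τ h
  refine lt_of_le_of_ne (Finset.sum_le_sum fun K _ => localRank_mono h.le K) fun heq => ?_
  have heq' : ∀ K, σ.localRank K = τ.localRank K := fun K =>
    (Finset.sum_eq_sum_iff_of_le fun K _ => localRank_mono h.le K).1 heq K (Finset.mem_univ K)
  refine h.not_ge (le_of_collapses_of_stabilizer_le h.le (fun K hτ => ?_) fun K hτ => ?_)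
  · by_contra hσ
    have := heq' K
    rw [localRank, localRank, if_neg hσ, if_pos hτ] at this
    exact (heightBelow_lt_posetHeight _).ne this
  · have := heq' K
    rw [localRank, localRank, if_neg hτ, if_neg fun hσ => hτ (hσ.mono h.le)] at this
    by_contra hlt
    exact (heightBelow_strictMono
      (lt_of_le_not_ge (stabilizer_mono h.le K) hlt)).ne this

/-! ### A long chain of right congruences -/

/-- The right congruence that identifies all mappings after `K` in the linear extension, and the
mappings with kernel `K` that differ by a permutation of the kernel classes belonging to `H`. The
last clause needs no condition on `f`: if `f` is not injective, both mappings come after `K`. -/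
def layer (K : Setoid (Fin n)) (H : Subgroup (Equiv.Perm (Quotient K))) :
    RightCongruence (FullTransformation n) where
  r α β := α = β ∨ (α ∈ above K ∧ β ∈ above K) ∨
    ∃ π ∈ H, ∃ f, α = ofQuotient K f ∧ β = ofQuotient K (f ∘ π)
  iseqv := by
    have hmem : ∀ (f : Quotient K → Fin n) (π : Equiv.Perm (Quotient K)),
        ofQuotient K (f ∘ π) ∈ above K ↔ ofQuotient K f ∈ above K := fun f π => by
      rw [ofQuotient_mem_above_iff, ofQuotient_mem_above_iff, π.injective_comp]
    refine ⟨fun _ => Or.inl rfl, ?_, ?_⟩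
    · rintro α β (rfl | h | ⟨π, hπ, f, rfl, rfl⟩)
      · exact Or.inl rfl
      · exact Or.inr (Or.inl h.symm)
      · exact Or.inr (Or.inr ⟨π⁻¹, H.inv_mem hπ, f ∘ π, rfl, by congr 1; ext q; simp⟩)
    · rintro α β γ (rfl | h | ⟨π, hπ, f, rfl, rfl⟩)
      · exact id
      · rintro (rfl | h' | ⟨ρ, hρ, g, rfl, rfl⟩)
        · exact Or.inr (Or.inl h)
        · exact Or.inr (Or.inl ⟨h.1, h'.2⟩)
        · exact Or.inr (Or.inl ⟨h.1, (hmem g ρ).2 h.2⟩)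
      · rintro (rfl | h' | ⟨ρ, hρ, g, hg, rfl⟩)
        · exact Or.inr (Or.inr ⟨π, hπ, f, rfl, rfl⟩)
        · exact Or.inr (Or.inl ⟨(hmem f π).1 h'.1, h'.2⟩)
        · obtain rfl := ofQuotient_injective K hg
          exact Or.inr (Or.inr ⟨π * ρ, H.mul_mem hπ hρ, f, rfl, rfl⟩)
  mul_right := by
    rintro α β γ (rfl | h | ⟨π, hπ, f, rfl, rfl⟩)
    · exact Or.inl rfl
    · exact Or.inr (Or.inl ⟨mul_mem_above h.1 γ, mul_mem_above h.2 γ⟩)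
    · exact Or.inr (Or.inr ⟨π, hπ, γ ∘ f, rfl, rfl⟩)

theorem layer_le_layer_iff {K : Setoid (Fin n)} {H H' : Subgroup (Equiv.Perm (Quotient K))} :
    layer K H ≤ layer K H' ↔ H ≤ H' := by
  constructor
  · intro h π hπ
    obtain ⟨f, hf⟩ := exists_injective_quotient K
    have hr : (layer K H').r (ofQuotient K f) (ofQuotient K (f ∘ π)) :=
      h (Or.inr (Or.inr ⟨π, hπ, f, rfl, rfl⟩))
    rcases hr with hr | ⟨hr, -⟩ | ⟨ρ, hρ, g, hg, hg'⟩
    · obtain rfl : π = 1 := Equiv.ext fun q => (hf (congrFun (ofQuotient_injective K hr) q)).symm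
      exact H'.one_mem
    · exact absurd hf (ofQuotient_mem_above_iff.1 hr)
    · obtain rfl := ofQuotient_injective K hg
      obtain rfl : π = ρ := Equiv.ext fun q => hf (congrFun (ofQuotient_injective K hg') q)
      exact hρ
  · rintro h α β (rfl | h' | ⟨π, hπ, hf⟩)
    · exact Or.inl rfl
    · exact Or.inr (Or.inl h')
    · exact Or.inr (Or.inr ⟨π, h hπ, hf⟩)

/-- Everything identified by `layer K H` is trivial or has kernel at or after `K`. -/
theorem layer_le_layer_of_lt {K K' : Setoid (Fin n)}
    (h : toLinearExtension K' < toLinearExtension K) (H : Subgroup (Equiv.Perm (Quotient K)))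
    (H' : Subgroup (Equiv.Perm (Quotient K'))) : layer K H ≤ layer K' H' := by
  have hle : ∀ f, ofQuotient K f ∈ above K' := fun f =>
    lt_of_lt_of_le h (toLinearExtension.monotone (le_ker_ofQuotient K f))
  rintro α β (rfl | h' | ⟨π, -, f, rfl, rfl⟩)
  · exact Or.inl rfl
  · exact Or.inr (Or.inl ⟨lt_trans h h'.1, lt_trans h h'.2⟩)
  · exact Or.inr (Or.inl ⟨hle _, hle _⟩)

/-- A witness that `layer K H` does not identify everything with kernel at or after `K`. If `K` is
the universal kernel, it consists of two constant mappings. -/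
theorem exists_not_layer_rel (hn : 2 ≤ n) (K : Setoid (Fin n))
    (H : Subgroup (Equiv.Perm (Quotient K))) :
    ∃ α β, K ≤ ker α ∧ K ≤ ker β ∧ ¬ (layer K H).r α β := by
  obtain ⟨f, hf⟩ := exists_injective_quotient K
  obtain ⟨c, hc⟩ : ∃ c : Fin n, Set.range f ≠ {c} := by
    by_contra! h
    have := (h ⟨0, by omega⟩).symm.trans (h ⟨1, by omega⟩)
    simp at this
  let x : Fin n := ⟨0, by omega⟩
  have hconst : Set.range (fun _ : Quotient K => c) = {c} :=
    haveI : Nonempty (Quotient K) := ⟨Quotient.mk K x⟩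
    Set.range_const
  refine ⟨ofQuotient K f, ofQuotient K fun _ => c, le_ker_ofQuotient _ _, le_ker_ofQuotient _ _, ?_⟩
  rintro (h | ⟨h, -⟩ | ⟨π, -, g, hg, hg'⟩)
  · rw [ofQuotient_injective K h] at hc
    exact hc hconst
  · exact ofQuotient_mem_above_iff.1 h hf
  · obtain rfl := ofQuotient_injective K hg
    have := ofQuotient_injective K hg'
    rw [this, π.surjective.range_comp] at hconst
    exact hc hconst

/-- The right congruence with a single class. -/
def universal (S : Type*) [Semigroup S] : RightCongruence S where
  toSetoid := ⊤
  mul_right _ _ := trivial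

/-- The right congruences `layer K H` for `H` in given chains `C K`, and the universal one. -/
def chainElement (C : ∀ K : Setoid (Fin n), Set (Subgroup (Equiv.Perm (Quotient K)))) :
    Option (Σ K, C K) → RightCongruence (FullTransformation n)
  | none => universal _
  | some p => layer p.1 p.2

theorem isChain_range_chainElement
    {C : ∀ K : Setoid (Fin n), Set (Subgroup (Equiv.Perm (Quotient K)))}
    (hC : ∀ K, IsChain (· ≤ ·) (C K)) : IsChain (· ≤ ·) (Set.range (chainElement C)) := by
  rintro _ ⟨_ | ⟨K, H⟩, rfl⟩ _ ⟨_ | ⟨K', H'⟩, rfl⟩ -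
  · exact Or.inl fun _ _ _ => trivial
  · exact Or.inr fun _ _ _ => trivial
  · exact Or.inl fun _ _ _ => trivial
  · rcases lt_trichotomy (toLinearExtension K) (toLinearExtension K') with h | h | h
    · exact Or.inr (layer_le_layer_of_lt h _ _)
    · obtain rfl : K = K' := h
      exact ((hC K).total H.2 H'.2).imp layer_le_layer_iff.2 layer_le_layer_iff.2
    · exact Or.inl (layer_le_layer_of_lt h _ _)

theorem chainElement_injective (hn : 2 ≤ n)
    (C : ∀ K : Setoid (Fin n), Set (Subgroup (Equiv.Perm (Quotient K)))) :
    Function.Injective (chainElement C) := by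
  have htop : ∀ K H, universal (FullTransformation n) ≠ layer K H := fun K H h => by
    obtain ⟨α, β, -, -, hr⟩ := exists_not_layer_rel hn K H
    exact hr (h ▸ trivial)
  have hlt : ∀ {K K'}, toLinearExtension K' < toLinearExtension K → ∀ H H',
      layer K H ≠ layer K' H' := fun {K K'} hK H H' h => by
    obtain ⟨α, β, hα, hβ, hr⟩ := exists_not_layer_rel hn K H
    refine hr ?_
    rw [h]
    exact Or.inr (Or.inl ⟨lt_of_lt_of_le hK (toLinearExtension.monotone hα),
      lt_of_lt_of_le hK (toLinearExtension.monotone hβ)⟩)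
  rintro (_ | ⟨K, H⟩) (_ | ⟨K', H'⟩) h
  · rfl
  · exact absurd h (htop _ _)
  · exact absurd h.symm (htop _ _)
  · rcases lt_trichotomy (toLinearExtension K) (toLinearExtension K') with hK | hK | hK
    · exact absurd h.symm (hlt hK _ _)
    · obtain rfl : K = K' := hK
      have hH : H = H' := Subtype.ext (le_antisymm (layer_le_layer_iff.1 h.le)
        (layer_le_layer_iff.1 h.ge))
      rw [hH]
    · exact absurd h (hlt hK _ _)

/-! ### The height formula -/

/-- The height as a sum over all kernels. -/
theorem posetHeight_eq_sum_setoid (hn : 2 ≤ n) [Fintype (Setoid (Fin n))] :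
    posetHeight (RightCongruence (FullTransformation n)) =
      ((∑ K : Setoid (Fin n), (posetHeight (Subgroup (Equiv.Perm (Quotient K)))).toNat : ℕ) : ℕ∞)
        + 1 := by
  have : NeZero n := ⟨by omega⟩
  apply le_antisymm
  · exact posetHeight_le_of_strictMono sum_localRank_strictMono
      fun σ => Finset.sum_le_sum fun K _ => σ.localRank_le K
  · choose C hC hcard using fun K : Setoid (Fin n) =>
      exists_isChain_encard_eq_posetHeight (Subgroup (Equiv.Perm (Quotient K)))
    have hcard' : ∀ K, Nat.card (C K) =
        (posetHeight (Subgroup (Equiv.Perm (Quotient K)))).toNat := fun K => by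
      rw [← hcard K, Nat.card_coe_set_eq]
      rfl
    refine le_trans (le_of_eq ?_) (isChain_range_chainElement hC).encard_le_posetHeight
    rw [← Set.image_univ, (chainElement_injective hn C).encard_image, Set.encard_univ,
      ENat.card_eq_coe_natCard, Finite.card_option, Nat.card_sigma]
    simp only [hcard', Nat.cast_add, Nat.cast_one]

end RightCongruence

theorem posetHeight_subgroup_perm_eq {α : Type*} [Finite α] {r : ℕ} (h : Nat.card α = r) :
    posetHeight (Subgroup (Equiv.Perm α)) = posetHeight (Subgroup (Equiv.Perm (Fin r))) := by
  subst h
  exact (Equiv.permCongrHom (Finite.equivFin α)).mapSubgroup.posetHeight_eq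

theorem mainTheorem2 (n : ℕ) (hn : 2 ≤ n) :
    posetHeight (RightCongruence (FullTransformation n)) =
      1 + ∑ r ∈ Finset.Icc 1 n,
        (Nat.stirlingSecond n r : ℕ∞) * posetHeight (Subgroup (Equiv.Perm (Fin r))) := by
  classical
  let : Fintype (Setoid (Fin n)) := Fintype.ofFinite _
  have hclasses : ∀ K ∈ (Finset.univ : Finset (Setoid (Fin n))),
      Nat.card (Quotient K) ∈ Finset.Icc 1 n := fun K _ => by
    have : Nonempty (Quotient K) := ⟨Quotient.mk K ⟨0, by omega⟩⟩
    rw [Finset.mem_Icc]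
    exact ⟨Nat.card_pos, (Nat.card_le_card_of_surjective _ Quotient.mk_surjective).trans_eq
      (Nat.card_fin n)⟩
  rw [RightCongruence.posetHeight_eq_sum_setoid hn, add_comm, Nat.cast_sum,
    ← Finset.sum_fiberwise_of_maps_to hclasses]
  congr 1
  refine Finset.sum_congr rfl fun r _ => ?_
  have hterm : ∀ K ∈ Finset.univ.filter fun K : Setoid (Fin n) => Nat.card (Quotient K) = r,
      ((posetHeight (Subgroup (Equiv.Perm (Quotient K)))).toNat : ℕ∞) =
        posetHeight (Subgroup (Equiv.Perm (Fin r))) := fun K hK => by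
    rw [ENat.natCast_toNat (posetHeight_ne_top _),
      posetHeight_subgroup_perm_eq (Finset.mem_filter.1 hK).2]
  rw [Finset.sum_congr rfl hterm, Finset.sum_const, nsmul_eq_mul, ← Fintype.card_subtype,
    ← Nat.card_eq_fintype_card, Setoid.card_quotient_eq_stirlingSecond]
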